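/- Let $p_0$ be a probability density on $\mathbb R$ (with respect to Lebesgue measure) and let $X_1, X_2, \ldots$ be independent random variables, each with law $P_0$, the probability measure with density $p_0$. Let $\mathcal F$ be a set of probability densities on $\mathbb R$, equipped with the Borel $\sigma$-algebra of the weak topology (the topology of weak convergence of the corresponding probability measures; $P$ denotes the measure with density $p$), such that $(p,x) \mapsto p(x)$ is jointly measurable on $\mathcal F \times \mathbb R$. For each sample size $n$ let $\Pi_n$ be a prior, that is, a probability measure on $\mathcal F$. The posterior probability of $A \subseteq \mathcal F$ is $$\Pi_n(A \mid X_1,\ldots,X_n) = \frac{\int_A \prod_{i=1}^n \frac{p(X_i)}{p_0(X_i)}\, d\Pi_n(p)}{\int_{\mathcal F} \prod_{i=1}^n \frac{p(X_i)}{p_0(X_i)}\, d\Pi_n(p)}.$$ For $r \geq 1$ and Borel probability measures $P,Q$ on $\mathbb R$ let $M_r(P) = \int |x|^r\, dP(x) \in [0,\infty]$ and $$W_r(P,Q) = \inf_{\gamma} \Big( \int_{\mathbb R^2} |x-y|^r \, d\gamma(x,y) \Big)^{1/r} \in [0,\infty],$$ where the infimum is over all Borel probability measures $\gamma$ on $\mathbb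 R^2$ with marginals $P$ and $Q$. Let $\mathrm{KL}(p_0,p) = \int \log\frac{p_0}{p}\, dP_0 \in [0,\infty]$ be the Kullback--Leibler divergence. Let $1 \leq r < \infty$. Assume that the priors satisfy the Kullback--Leibler support condition $$\liminf_{n\to\infty} \Pi_n\big( p \in \mathcal F : \mathrm{KL}(p_0,p) < \epsilon \big) > 0 \quad \text{for every } \epsilon > 0,$$ and that there exist constants $K > 0$ and $\delta > 0$ such that $M_{r+\delta}(P_0) < \infty$ and $$\Pi_n\big( M_{r+\delta}(P) \leq K \mid X_1,\ldots,X_n \big) \longrightarrow 1 \quad \text{in probability}.$$ Then for every $\epsilon > 0$, $$\Pi_n\big( W_r(P,P_0) > \epsilon \mid X_1,\ldots,X_n \big) \longrightarrow 0 \quad \text{in probability}.$$ -/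

import Mathlib

open MeasureTheory ProbabilityTheory Filter Topology
open scoped ENNReal NNReal

noncomputable section

/-- A probability density on `ℝ` with respect to Lebesgue measure. -/
structure ProbDensity where
  toFun : ℝ → ℝ≥0
  measurable_toFun : Measurable toFun
  lintegral_eq_one : ∫⁻ x, (toFun x : ℝ≥0∞) = 1

namespace ProbDensity

instance : CoeFun ProbDensity (fun _ => ℝ → ℝ≥0) := ⟨toFun⟩

/-- The probability measure `P` with density `p`. -/
def toMeasure (p : ProbDensity) : Measure ℝ :=
  volume.withDensity (fun x => (p x : ℝ≥0∞))

instance (p : ProbDensity) : IsProbabilityMeasure p.toMeasure :=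
  ⟨by simp [toMeasure, p.lintegral_eq_one]⟩

/-- `toMeasure` as an element of Mathlib's space of probability measures. -/
def toProbabilityMeasure (p : ProbDensity) : ProbabilityMeasure ℝ :=
  ⟨p.toMeasure, inferInstance⟩

/-- The weak topology on densities, that is, the topology of weak convergence of the
corresponding probability measures. -/
instance : TopologicalSpace ProbDensity :=
  TopologicalSpace.induced toProbabilityMeasure inferInstance

/-- The Borel σ-algebra of the weak topology. -/
instance : MeasurableSpace ProbDensity := borel ProbDensity

instance : BorelSpace ProbDensity := ⟨rfl⟩

end ProbDensity

/-- The absolute moment `M_r(P) = ∫ |x|^r dP(x)`, with values in `[0, ∞]`. -/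
def absMoment (r : ℝ) (P : Measure ℝ) : ℝ≥0∞ :=
  ∫⁻ x, ENNReal.ofReal (|x| ^ r) ∂P

/-- The couplings of `P` and `Q`: the Borel measures on `ℝ²` with marginals `P` and `Q`
(automatically probability measures when `P` and `Q` are). -/
def couplings (P Q : Measure ℝ) : Set (Measure (ℝ × ℝ)) :=
  {γ | γ.map Prod.fst = P ∧ γ.map Prod.snd = Q}

/-- The Wasserstein distance `W_r(P, Q)`, with values in `[0, ∞]`. -/
def wasserstein (r : ℝ) (P Q : Measure ℝ) : ℝ≥0∞ :=
  ⨅ γ ∈ couplings P Q, (∫⁻ z, ENNReal.ofReal (|z.1 - z.2| ^ r) ∂γ) ^ (1 / r)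

/-- The likelihood ratio `∏ᵢ p(xᵢ) / p₀(xᵢ)`. -/
def likelihoodRatio (p₀ p : ProbDensity) {n : ℕ} (x : Fin n → ℝ) : ℝ≥0∞ :=
  ((∏ i, p (x i) / p₀ (x i) : ℝ≥0) : ℝ≥0∞)

/-- The posterior probability of `A ⊆ F` given the observations `x₁, …, xₙ`, for the prior `Pr`
on the family of densities `F`, by the Bayes formula. -/
def posteriorProb {F : Set ProbDensity} (Pr : Measure F) (p₀ : ProbDensity) {n : ℕ}
    (x : Fin n → ℝ) (A : Set F) : ℝ≥0∞ :=
  (∫⁻ p in A, likelihoodRatio p₀ p x ∂Pr) / ∫⁻ p, likelihoodRatio p₀ p x ∂Pr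

/-- The Kullback-Leibler support condition for a sequence of priors:
`liminf Πₙ(p : K(p₀, p) < ε) > 0` for every `ε > 0`. -/
def KLSupport {F : Set ProbDensity} (Pr : ℕ → Measure F) (p₀ : ProbDensity) : Prop :=
  ∀ ε : ℝ, 0 < ε → 0 < liminf (fun n => Pr n {p : F |
    InformationTheory.klDiv p₀.toMeasure (p : ProbDensity).toMeasure < ENNReal.ofReal ε}) atTop

end

/-! With the `(r + δ)`-moments bounded, Wasserstein closeness is a matter of finitely many
probabilities. Cut the line into a tail and short cells. If `P` exceeds `P₀` by at most `η` on every
piece, then, both having total mass one, the mass that cannot be matched within its own piece is at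
most the number of pieces times `η`. Matched mass in a short cell moves little, and matched tail
mass is paid for by the moments (`exists_coupling_cost_le`, `exists_finite_family_wasserstein_le`).

So, outside the event where the moment bound fails, it remains to treat the finitely many sets of
`p` with `P(C) ≥ P₀(C) + η`. The empirical frequency of `C`, compared with `P₀(C) + η/2`, tests each
such set uniformly: Chernoff bounds give errors at most `exp(-nη²/16)` on both sides, with no
covering or entropy argument. The Kullback-Leibler condition keeps the denominator of the posterior
above a multiple of `exp(-nη²/32)` with probability close to one
(`eventually_measure_evidence_lt_le`), so the posterior mass of each set vanishes
(`tendsto_measure_le_posteriorProb`). -/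

/-! ### Couplings glued from products, and their cost -/

lemma sum_smul_prod_mem_couplings {κ : Type*} [Fintype κ] (P Q : κ → Measure ℝ)
    [∀ k, IsFiniteMeasure (P k)] [∀ k, IsFiniteMeasure (Q k)]
    (h : ∀ k, P k Set.univ = Q k Set.univ) :
    ∑ k, (P k Set.univ)⁻¹ • (P k).prod (Q k) ∈ couplings (∑ k, P k) (∑ k, Q k) := by
  constructor <;> ext s hs
  · rw [Measure.map_apply measurable_fst hs, ← Set.prod_univ]
    simp only [Measure.finsetSum_apply, Measure.smul_apply, Measure.prod_prod, smul_eq_mul, ← h]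
    refine Finset.sum_congr rfl fun k _ => ?_
    -- A null piece has inverse mass `∞`, but its product measure vanishes, so it contributes
    -- nothing.
    by_cases h0 : P k Set.univ = 0
    · simp [measure_mono_null (Set.subset_univ s) h0]
    · rw [mul_comm (P k s), ← mul_assoc, ENNReal.inv_mul_cancel h0 (measure_ne_top _ _), one_mul]
  · rw [Measure.map_apply measurable_snd hs, ← Set.univ_prod]
    simp only [Measure.finsetSum_apply, Measure.smul_apply, Measure.prod_prod, smul_eq_mul]
    refine Finset.sum_congr rfl fun k _ => ?_
    by_cases h0 : P k Set.univ = 0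
    · simp [measure_mono_null (Set.subset_univ s) ((h k).symm.trans h0), h0]
    · rw [← mul_assoc, ENNReal.inv_mul_cancel h0 (measure_ne_top _ _), one_mul]

lemma ofReal_abs_sub_rpow_le {r : ℝ} (hr : 1 ≤ r) (x y : ℝ) :
    ENNReal.ofReal (|x - y| ^ r) ≤
      ENNReal.ofReal (2 ^ r) * (ENNReal.ofReal (|x| ^ r) + ENNReal.ofReal (|y| ^ r)) := by
  have h0 : (0 : ℝ) ≤ r := by linarith
  rw [← ENNReal.ofReal_add (by positivity) (by positivity),
    ← ENNReal.ofReal_mul (by positivity)]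
  refine ENNReal.ofReal_le_ofReal ?_
  have hm : |x - y| ≤ 2 * max |x| |y| := by
    have h1 := abs_sub x y
    have h2 := le_max_left |x| |y|
    have h3 := le_max_right |x| |y|
    linarith
  have hmax : (max |x| |y|) ^ r ≤ |x| ^ r + |y| ^ r := by
    rcases max_choice |x| |y| with h | h <;> rw [h]
    · linarith [Real.rpow_nonneg (abs_nonneg y) r]
    · linarith [Real.rpow_nonneg (abs_nonneg x) r]
  calc |x - y| ^ r ≤ (2 * max |x| |y|) ^ r := Real.rpow_le_rpow (abs_nonneg _) hm h0
    _ = 2 ^ r * (max |x| |y|) ^ r :=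
        Real.mul_rpow (by norm_num) ((abs_nonneg x).trans (le_max_left _ _))
    _ ≤ _ := by gcongr

lemma measurable_ofReal_abs_rpow (r : ℝ) : Measurable fun x : ℝ => ENNReal.ofReal (|x| ^ r) := by
  fun_prop

/-- Crude cost for mass whose location is not controlled: the cost splits into a function of each
coordinate, and the mass of the other factor cancels the normalisation. -/
lemma inv_mul_lintegral_prod_le_absMoment {r : ℝ} (hr : 1 ≤ r) (P Q : Measure ℝ)
    [IsFiniteMeasure P] [IsFiniteMeasure Q] (h : P Set.univ = Q Set.univ) :
    (P Set.univ)⁻¹ * ∫⁻ z, ENNReal.ofReal (|z.1 - z.2| ^ r) ∂(P.prod Q) ≤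
      ENNReal.ofReal (2 ^ r) * (absMoment r P + absMoment r Q) := by
  have h1 : ∫⁻ z, ENNReal.ofReal (|z.1 - z.2| ^ r) ∂(P.prod Q) ≤
      ENNReal.ofReal (2 ^ r) * (absMoment r P + absMoment r Q) * P Set.univ := by
    calc ∫⁻ z, ENNReal.ofReal (|z.1 - z.2| ^ r) ∂(P.prod Q)
        ≤ ∫⁻ z, ENNReal.ofReal (2 ^ r) *
          (ENNReal.ofReal (|z.1| ^ r) + ENNReal.ofReal (|z.2| ^ r)) ∂(P.prod Q) :=
          lintegral_mono fun z => ofReal_abs_sub_rpow_le hr z.1 z.2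
      _ = _ := by
          rw [lintegral_const_mul _ (by fun_prop), lintegral_add_left (by fun_prop),
            ← lintegral_map (f := fun x : ℝ => ENNReal.ofReal (|x| ^ r)) (g := Prod.fst)
              (by fun_prop) measurable_fst,
            ← lintegral_map (f := fun x : ℝ => ENNReal.ofReal (|x| ^ r)) (g := Prod.snd)
              (by fun_prop) measurable_snd,
            Measure.map_fst_prod, Measure.map_snd_prod, lintegral_smul_measure,
            lintegral_smul_measure, ← h, smul_eq_mul, smul_eq_mul, absMoment, absMoment]
          ring
  calc _ ≤ (P Set.univ)⁻¹ *
        (ENNReal.ofReal (2 ^ r) * (absMoment r P + absMoment r Q) * P Set.univ) := by gcongr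
    _ = ENNReal.ofReal (2 ^ r) * (absMoment r P + absMoment r Q) *
        ((P Set.univ)⁻¹ * P Set.univ) := by ring
    _ ≤ ENNReal.ofReal (2 ^ r) * (absMoment r P + absMoment r Q) * 1 := by
        gcongr
        exact ENNReal.inv_mul_le_one _
    _ = _ := mul_one _

lemma inv_mul_lintegral_prod_le_of_diam {r h : ℝ} (hr : 0 ≤ r) (P Q : Measure ℝ)
    [IsFiniteMeasure P] [IsFiniteMeasure Q] (hPQ : P Set.univ = Q Set.univ) {S : Set ℝ}
    (hS : ∀ x ∈ S, ∀ y ∈ S, |x - y| ≤ h) (hP : ∀ᵐ x ∂P, x ∈ S) (hQ : ∀ᵐ x ∂Q, x ∈ S) :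
    (P Set.univ)⁻¹ * ∫⁻ z, ENNReal.ofReal (|z.1 - z.2| ^ r) ∂(P.prod Q) ≤
      ENNReal.ofReal (h ^ r) * P Set.univ := by
  have h1 : ∫⁻ z, ENNReal.ofReal (|z.1 - z.2| ^ r) ∂(P.prod Q) ≤
      ENNReal.ofReal (h ^ r) * P Set.univ * P Set.univ := by
    rw [lintegral_prod _ (by fun_prop)]
    calc _ ≤ ∫⁻ _, ENNReal.ofReal (h ^ r) * P Set.univ ∂P := by
            refine lintegral_mono_ae ?_
            filter_upwards [hP] with x hx
            calc _ ≤ ∫⁻ _, ENNReal.ofReal (h ^ r) ∂Q := by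
                    refine lintegral_mono_ae ?_
                    filter_upwards [hQ] with y hy
                    exact ENNReal.ofReal_le_ofReal
                      (Real.rpow_le_rpow (abs_nonneg _) (hS x hx y hy) hr)
              _ = _ := by rw [lintegral_const, hPQ]
      _ = _ := by rw [lintegral_const]
  calc _ ≤ (P Set.univ)⁻¹ * (ENNReal.ofReal (h ^ r) * P Set.univ * P Set.univ) := by gcongr
    _ = ENNReal.ofReal (h ^ r) * P Set.univ * ((P Set.univ)⁻¹ * P Set.univ) := by ring
    _ ≤ ENNReal.ofReal (h ^ r) * P Set.univ * 1 := by
        gcongr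
        exact ENNReal.inv_mul_le_one _
    _ = _ := mul_one _

/-- A partition of the line into a tail and finitely many short cells. -/
lemma exists_finite_partition {R h : ℝ} (hh : 0 < h) :
    ∃ (N : ℕ) (C : Option (Fin N) → Set ℝ), (∀ k, MeasurableSet (C k)) ∧
      Pairwise (Function.onFun Disjoint C) ∧ (⋃ k, C k) = Set.univ ∧
      (∀ x ∈ C none, R ≤ |x|) ∧ (∀ x ∉ C none, |x| ≤ R) ∧
      ∀ k, ∀ x ∈ C (some k), ∀ y ∈ C (some k), |x - y| ≤ h := by
  -- Index of the cell of length `h`, counted from `-R`. The natural floor is meaningful only for `x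
  -- ≥ -R`, hence the intersection with `Set.Ico (-R) R` below.
  let f : ℝ → ℕ := fun x => ⌊(x + R) / h⌋₊
  have hf : Measurable f := Nat.measurable_floor.comp (by fun_prop)
  have hfs : ∀ x, -R ≤ x → (f x : ℝ) * h ≤ x + R ∧ x + R < (f x + 1) * h := fun x hx =>
    ⟨(le_div_iff₀ hh).1 (Nat.floor_le (div_nonneg (by linarith) hh.le)),
      (div_lt_iff₀ hh).1 (Nat.lt_floor_add_one _)⟩
  refine ⟨⌈2 * R / h⌉₊, fun k => k.elim (Set.Ico (-R) R)ᶜ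
    (fun k => Set.Ico (-R) R ∩ f ⁻¹' {(k : ℕ)}), ?_, ?_, ?_, ?_, ?_, ?_⟩
  · rintro (_ | k)
    · exact measurableSet_Ico.compl
    · exact measurableSet_Ico.inter (hf (measurableSet_singleton _))
  · rintro (_ | k) (_ | l) hkl
    · exact absurd rfl hkl
    · exact Set.disjoint_left.2 fun x hx hy => hx hy.1
    · exact Set.disjoint_left.2 fun x hx hy => hy hx.1
    · refine Set.disjoint_left.2 fun x hx hy => hkl ?_
      have : (k : ℕ) = l := hx.2.symm.trans hy.2
      rw [Fin.ext this]
  · refine Set.eq_univ_of_forall fun x => Set.mem_iUnion.2 ?_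
    by_cases hx : x ∈ Set.Ico (-R) R
    · have : f x < ⌈2 * R / h⌉₊ := by
        rw [Nat.lt_ceil, lt_div_iff₀ hh]
        linarith [(hfs x hx.1).1, hx.2]
      exact ⟨some ⟨f x, this⟩, hx, rfl⟩
    · exact ⟨none, hx⟩
  · intro x hx
    by_contra! hlt
    exact hx ⟨(abs_lt.1 hlt).1.le, (abs_lt.1 hlt).2⟩
  · intro x hx
    have hx' : x ∈ Set.Ico (-R) R := not_not.1 hx
    exact abs_le.2 ⟨hx'.1, hx'.2.le⟩
  · rintro k x ⟨hx, hxk⟩ y ⟨hy, hyk⟩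
    have h1 := hfs x hx.1
    have h2 := hfs y hy.1
    rw [show f x = k from hxk] at h1
    rw [show f y = k from hyk] at h2
    rw [abs_le]
    constructor <;> linarith [h1.1, h1.2, h2.1, h2.2]

/-- Meant for the unmatched part `P'` of `P`: off the tail its small mass makes the moment small,
and on the tail `P` dominates it. -/
lemma absMoment_le_of_le_on_tail {r R : ℝ} (hr : 0 ≤ r) {P' P : Measure ℝ} (hle : P' ≤ P)
    {T : Set ℝ} (hT : MeasurableSet T) (hTR : ∀ x ∉ T, |x| ≤ R) :
    absMoment r P' ≤ ENNReal.ofReal (R ^ r) * P' Set.univ + absMoment r (P.restrict T) := by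
  calc absMoment r P' = absMoment r (P'.restrict Tᶜ) + absMoment r (P'.restrict T) := by
        rw [add_comm]; exact (lintegral_add_compl _ hT).symm
    _ ≤ _ := by
        refine add_le_add ?_ (lintegral_mono' (Measure.restrict_mono le_rfl hle) le_rfl)
        calc absMoment r (P'.restrict Tᶜ) ≤ ∫⁻ _ in Tᶜ, ENNReal.ofReal (R ^ r) ∂P' :=
              setLIntegral_mono' hT.compl fun x hx => ENNReal.ofReal_le_ofReal
                (Real.rpow_le_rpow (abs_nonneg _) (hTR x hx) hr)
          _ ≤ _ := by
              rw [setLIntegral_const]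
              gcongr
              exact Set.subset_univ _

/-- Where `|x| ≥ R`, one has `|x|^r ≤ R^(-δ) |x|^(r+δ)`; this is where the extra `δ` of moments is
spent. -/
lemma absMoment_restrict_tail_le {r δ R : ℝ} (hδ : 0 ≤ δ) (hR : 0 < R) (P : Measure ℝ)
    {T : Set ℝ} (hT : MeasurableSet T) (hTR : ∀ x ∈ T, R ≤ |x|) :
    absMoment r (P.restrict T) ≤ ENNReal.ofReal (R ^ (-δ)) * absMoment (r + δ) P := by
  calc absMoment r (P.restrict T)
      ≤ ∫⁻ x in T, ENNReal.ofReal (R ^ (-δ)) * ENNReal.ofReal (|x| ^ (r + δ)) ∂P := by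
        refine setLIntegral_mono' hT fun x hx => ?_
        rw [← ENNReal.ofReal_mul (by positivity)]
        refine ENNReal.ofReal_le_ofReal ?_
        have hx0 : 0 < |x| := hR.trans_le (hTR x hx)
        rw [Real.rpow_neg hR.le, Real.rpow_add hx0, inv_mul_eq_div, le_div_iff₀ (by positivity)]
        gcongr
        exact hTR x hx
    _ ≤ ∫⁻ x, ENNReal.ofReal (R ^ (-δ)) * ENNReal.ofReal (|x| ^ (r + δ)) ∂P :=
        setLIntegral_le_lintegral _ _
    _ = _ := by rw [lintegral_const_mul _ (by fun_prop), absMoment]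

lemma sum_restrict_eq_of_partition {κ : Type*} [Fintype κ] {C : κ → Set ℝ}
    (hC : ∀ k, MeasurableSet (C k)) (hd : Pairwise (Function.onFun Disjoint C))
    (hU : (⋃ k, C k) = Set.univ) (P : Measure ℝ) : ∑ k, P.restrict (C k) = P := by
  rw [← Measure.sum_fintype, ← Measure.restrict_iUnion hd hC, hU, Measure.restrict_univ]

/-- Matching the mass of two measures cell by cell, and the excess mass arbitrarily, gives a
coupling of controlled cost. -/
lemma exists_coupling_cost_le {r R h : ℝ} (hr : 1 ≤ r) (P Q : Measure ℝ)
    [IsProbabilityMeasure P] [IsProbabilityMeasure Q] {N : ℕ} {C : Option (Fin N) → Set ℝ}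
    (hC : ∀ k, MeasurableSet (C k)) (hd : Pairwise (Function.onFun Disjoint C))
    (hU : (⋃ k, C k) = Set.univ) (hT : ∀ x ∉ C none, |x| ≤ R)
    (hh : ∀ k, ∀ x ∈ C (some k), ∀ y ∈ C (some k), |x - y| ≤ h) {η : ℝ≥0∞}
    (hη : ∀ k, P (C k) ≤ Q (C k) + η) :
    ∃ γ ∈ couplings P Q, ∫⁻ z, ENNReal.ofReal (|z.1 - z.2| ^ r) ∂γ ≤
      ENNReal.ofReal (h ^ r) + 2 * ENNReal.ofReal (2 ^ r) *
        (absMoment r (P.restrict (C none)) + absMoment r (Q.restrict (C none)) +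
          ENNReal.ofReal (R ^ r) * ((N + 1) * η)) := by
  have hr0 : 0 ≤ r := by linarith
  let a : Option (Fin N) → ℝ≥0∞ := fun k => P (C k)
  let b : Option (Fin N) → ℝ≥0∞ := fun k => Q (C k)
  -- The mass common to `P` and `Q` in each piece; `u` and `v` are the fractions of `P` and `Q` that
  -- it represents, equal to `0` on null pieces.
  let m : Option (Fin N) → ℝ≥0∞ := fun k => min (a k) (b k)
  let u : Option (Fin N) → ℝ≥0∞ := fun k => m k / a k
  let v : Option (Fin N) → ℝ≥0∞ := fun k => m k / b k
  have hu1 : ∀ k, u k ≤ 1 := fun k =>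
    (ENNReal.div_le_div_right (min_le_left _ _) _).trans ENNReal.div_self_le_one
  have hv1 : ∀ k, v k ≤ 1 := fun k =>
    (ENNReal.div_le_div_right (min_le_right _ _) _).trans ENNReal.div_self_le_one
  have hua : ∀ k, u k * a k = m k := fun k => by
    refine ENNReal.div_mul_cancel' (fun h0 => ?_) fun h0 => absurd h0 (measure_ne_top _ _)
    exact le_antisymm ((min_le_left _ _).trans h0.le) zero_le
  have hvb : ∀ k, v k * b k = m k := fun k => by
    refine ENNReal.div_mul_cancel' (fun h0 => ?_) fun h0 => absurd h0 (measure_ne_top _ _)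
    exact le_antisymm ((min_le_right _ _).trans h0.le) zero_le
  have hm_ne : ∀ k, m k ≠ ∞ := fun k =>
    ((min_le_left _ _).trans_lt (measure_lt_top P _)).ne
  let Pk : Option (Fin N) → Measure ℝ := fun k => u k • P.restrict (C k)
  let Qk : Option (Fin N) → Measure ℝ := fun k => v k • Q.restrict (C k)
  let P' : Measure ℝ := ∑ k, (1 - u k) • P.restrict (C k)
  let Q' : Measure ℝ := ∑ k, (1 - v k) • Q.restrict (C k)
  have hPk_univ : ∀ k, Pk k Set.univ = m k := fun k => by simp [Pk, ← hua, a]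
  have hQk_univ : ∀ k, Qk k Set.univ = m k := fun k => by simp [Qk, ← hvb, b]
  have hPsum : P' + ∑ k, Pk k = P := by
    conv_rhs => rw [← sum_restrict_eq_of_partition hC hd hU P]
    rw [← Finset.sum_add_distrib]
    refine Finset.sum_congr rfl fun k _ => ?_
    rw [← add_smul, tsub_add_cancel_of_le (hu1 k), one_smul]
  have hQsum : Q' + ∑ k, Qk k = Q := by
    conv_rhs => rw [← sum_restrict_eq_of_partition hC hd hU Q]
    rw [← Finset.sum_add_distrib]
    refine Finset.sum_congr rfl fun k _ => ?_
    rw [← add_smul, tsub_add_cancel_of_le (hv1 k), one_smul]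
  have hP'le : P' ≤ P := by
    conv_rhs => rw [← hPsum]
    exact Measure.le_add_right le_rfl
  have hQ'le : Q' ≤ Q := by
    conv_rhs => rw [← hQsum]
    exact Measure.le_add_right le_rfl
  have hP'fin : IsFiniteMeasure P' := isFiniteMeasure_of_le P hP'le
  have hQ'fin : IsFiniteMeasure Q' := isFiniteMeasure_of_le Q hQ'le
  have hPkfin : ∀ k, IsFiniteMeasure (Pk k) := fun k =>
    ⟨by rw [hPk_univ]; exact (hm_ne k).lt_top⟩
  have hQkfin : ∀ k, IsFiniteMeasure (Qk k) := fun k =>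
    ⟨by rw [hQk_univ]; exact (hm_ne k).lt_top⟩
  have hmsum : ∑ k, m k ≤ 1 := by
    have := congrArg (fun ρ : Measure ℝ => ρ Set.univ) hPsum
    simp only [Measure.add_apply, Measure.finsetSum_apply, hPk_univ, measure_univ] at this
    rw [← this]
    exact le_add_self
  have hP'Q' : P' Set.univ = Q' Set.univ := by
    have h1 := congrArg (fun ρ : Measure ℝ => ρ Set.univ) hPsum
    have h2 := congrArg (fun ρ : Measure ℝ => ρ Set.univ) hQsum
    simp only [Measure.add_apply, Measure.finsetSum_apply, hPk_univ, hQk_univ,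
      measure_univ] at h1 h2
    exact (ENNReal.add_left_inj (hmsum.trans_lt ENNReal.one_lt_top).ne).1 (h1.trans h2.symm)
  -- The excess of `P` is the sum of the positive parts of `P (C k) - Q (C k)`. Since `Q'` has the
  -- same mass, the one-sided hypothesis suffices.
  have hP'η : P' Set.univ ≤ (N + 1) * η := by
    calc P' Set.univ = ∑ k, (a k - m k) := by
          simp only [P', Measure.finsetSum_apply, Measure.smul_apply, smul_eq_mul,
            Measure.restrict_apply_univ]
          refine Finset.sum_congr rfl fun k _ => ?_
          rw [← hua k, ENNReal.sub_mul fun _ _ => measure_ne_top _ _, one_mul]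
      _ ≤ ∑ k : Option (Fin N), η := by
          refine Finset.sum_le_sum fun k _ => tsub_le_iff_left.2 ?_
          rcases le_total (a k) (b k) with hab | hab
          · simp [m, min_eq_left hab]
          · simpa [m, min_eq_right hab] using hη k
      _ = _ := by simp
  -- The outer `none` carries the excess, `some none` the matched tail, and the remaining indices
  -- the matched short cells.
  let PP : Option (Option (Fin N)) → Measure ℝ := fun k => k.elim P' Pk
  let QQ : Option (Option (Fin N)) → Measure ℝ := fun k => k.elim Q' Qk
  have hPP : ∀ k, IsFiniteMeasure (PP k) := by rintro (_ | k); exacts [hP'fin, hPkfin k]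
  have hQQ : ∀ k, IsFiniteMeasure (QQ k) := by rintro (_ | k); exacts [hQ'fin, hQkfin k]
  have hPQ : ∀ k, PP k Set.univ = QQ k Set.univ := by
    rintro (_ | k); exacts [hP'Q', (hPk_univ k).trans (hQk_univ k).symm]
  have hmem := sum_smul_prod_mem_couplings PP QQ hPQ
  rw [Fintype.sum_option (f := PP), Fintype.sum_option (f := QQ)] at hmem
  rw [show PP none + ∑ k, PP (some k) = P from hPsum,
    show QQ none + ∑ k, QQ (some k) = Q from hQsum] at hmem
  refine ⟨_, hmem, ?_⟩
  rw [lintegral_finsetSum_measure, Fintype.sum_option, Fintype.sum_option]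
  simp only [lintegral_smul_measure, smul_eq_mul]
  have e1 := inv_mul_lintegral_prod_le_absMoment hr P' Q' hP'Q'
  have e2 := inv_mul_lintegral_prod_le_absMoment hr (Pk none) (Qk none)
    ((hPk_univ none).trans (hQk_univ none).symm)
  have e3 : ∑ k, (Pk (some k) Set.univ)⁻¹ *
      ∫⁻ z, ENNReal.ofReal (|z.1 - z.2| ^ r) ∂((Pk (some k)).prod (Qk (some k))) ≤
      ENNReal.ofReal (h ^ r) := by
    calc _ ≤ ∑ k, ENNReal.ofReal (h ^ r) * Pk (some k) Set.univ := by
          refine Finset.sum_le_sum fun k _ => ?_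
          refine inv_mul_lintegral_prod_le_of_diam hr0 _ _
            ((hPk_univ _).trans (hQk_univ _).symm) (hh k) ?_ ?_
          · exact Measure.ae_smul_measure (ae_restrict_mem (hC _)) _
          · exact Measure.ae_smul_measure (ae_restrict_mem (hC _)) _
      _ ≤ ENNReal.ofReal (h ^ r) * 1 := by
          rw [← Finset.mul_sum]
          gcongr
          refine le_trans ?_ hmsum
          rw [Fintype.sum_option]
          simp only [hPk_univ]
          exact le_add_self
      _ = _ := mul_one _
  have m1 : absMoment r P' ≤ ENNReal.ofReal (R ^ r) * ((N + 1) * η) +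
      absMoment r (P.restrict (C none)) :=
    (absMoment_le_of_le_on_tail hr0 hP'le (hC none) hT).trans (by gcongr)
  have m2 : absMoment r Q' ≤ ENNReal.ofReal (R ^ r) * ((N + 1) * η) +
      absMoment r (Q.restrict (C none)) :=
    (absMoment_le_of_le_on_tail hr0 hQ'le (hC none) hT).trans (by rw [← hP'Q']; gcongr)
  have m3 : absMoment r (Pk none) ≤ absMoment r (P.restrict (C none)) := by
    simp only [Pk, absMoment, lintegral_smul_measure, smul_eq_mul]
    exact mul_le_of_le_one_left zero_le (hu1 none)
  have m4 : absMoment r (Qk none) ≤ absMoment r (Q.restrict (C none)) := by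
    simp only [Qk, absMoment, lintegral_smul_measure, smul_eq_mul]
    exact mul_le_of_le_one_left zero_le (hv1 none)
  -- The tail moments occur in the excess and in the matched tail, and the excess mass occurs for
  -- both `P'` and `Q'`: hence the factor 2.
  refine (add_le_add (e1.trans (mul_le_mul_right (add_le_add m1 m2) _))
    (add_le_add (e2.trans (mul_le_mul_right (add_le_add m3 m4) _)) e3)).trans (le_of_eq ?_)
  ring

/-- Under a moment bound, closeness in Wasserstein distance follows from one-sided closeness on
finitely many sets. -/
lemma exists_finite_family_wasserstein_le {r δ K ε : ℝ} (hr : 1 ≤ r) (hδ : 0 < δ) (hK : 0 < K)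
    (hε : 0 < ε) (Q : Measure ℝ) [IsProbabilityMeasure Q] (hQ : absMoment (r + δ) Q < ∞) :
    ∃ (N : ℕ) (C : Option (Fin N) → Set ℝ) (η : ℝ), 0 < η ∧ η ≤ 1 ∧
      (∀ k, MeasurableSet (C k)) ∧ ∀ (P : Measure ℝ) [IsProbabilityMeasure P],
        absMoment (r + δ) P ≤ ENNReal.ofReal K →
        (∀ k, P (C k) ≤ Q (C k) + ENNReal.ofReal η) →
        wasserstein r P Q ≤ ENNReal.ofReal ε := by
  have hr0 : 0 < r := by linarith
  set K₀ := (absMoment (r + δ) Q).toReal with hK₀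
  have hK₀' : 0 ≤ K₀ := ENNReal.toReal_nonneg
  have hQK : absMoment (r + δ) Q = ENNReal.ofReal K₀ := (ENNReal.ofReal_toReal hQ.ne).symm
  have hεr : 0 < ε ^ r := Real.rpow_pos_of_pos hε r
  have h2r : (0 : ℝ) < 2 ^ r := Real.rpow_pos_of_pos two_pos r
  -- The budget `ε ^ r` is split in three: `R` handles the tails, cell length `ε / 3` the matched
  -- cells, and `η`, chosen after `N`, the excess. Capping `η` at 1 serves the exponential bounds of
  -- the tests.
  obtain ⟨R, hR, hRle⟩ : ∃ R : ℝ, 0 < R ∧ R ^ (-δ) < ε ^ r / (3 * (2 * 2 ^ r) * (K + K₀)) := by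
    have h1 := (tendsto_rpow_neg_atTop hδ).eventually_lt_const
      (show 0 < ε ^ r / (3 * (2 * 2 ^ r) * (K + K₀)) by positivity)
    obtain ⟨R, h2, h3⟩ := (h1.and (eventually_gt_atTop 0)).exists
    exact ⟨R, h3, h2⟩
  obtain ⟨N, C, hC, hd, hU, hT1, hT2, hh⟩ := exists_finite_partition (R := R)
    (show 0 < ε / 3 by positivity)
  have hRr : 0 < R ^ r := Real.rpow_pos_of_pos hR r
  refine ⟨N, C, min 1 (ε ^ r / (3 * (2 * 2 ^ r) * R ^ r * (N + 1))), by positivity,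
    min_le_left _ _, hC, fun P _ hPK hPC => ?_⟩
  set η := min 1 (ε ^ r / (3 * (2 * 2 ^ r) * R ^ r * (N + 1))) with hη
  have hη0 : 0 < η := by positivity
  obtain ⟨γ, hγ, hcost⟩ := exists_coupling_cost_le hr P Q hC hd hU hT2 hh hPC
  have hcost' : ∫⁻ z, ENNReal.ofReal (|z.1 - z.2| ^ r) ∂γ ≤ ENNReal.ofReal (ε ^ r) := by
    have t1 := (absMoment_restrict_tail_le (r := r) hδ.le hR P (hC none) hT1).trans
      (mul_le_mul_right hPK _)
    have t2 := absMoment_restrict_tail_le (r := r) hδ.le hR Q (hC none) hT1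
    rw [hQK] at t2
    refine hcost.trans ((add_le_add_right (mul_le_mul_right
      (add_le_add_left (add_le_add t1 t2) _) _) _).trans ?_)
    rw [show (N + 1 : ℝ≥0∞) = ENNReal.ofReal (N + 1) by
        rw [ENNReal.ofReal_add (by positivity) zero_le_one]; simp,
      show (2 : ℝ≥0∞) = ENNReal.ofReal 2 by simp,
      ← ENNReal.ofReal_mul (by positivity), ← ENNReal.ofReal_mul (by positivity),
      ← ENNReal.ofReal_mul (by positivity), ← ENNReal.ofReal_mul (by positivity),
      ← ENNReal.ofReal_mul (by positivity), ← ENNReal.ofReal_add (by positivity) (by positivity),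
      ← ENNReal.ofReal_add (by positivity) (by positivity),
      ← ENNReal.ofReal_mul (by positivity), ← ENNReal.ofReal_add (by positivity) (by positivity)]
    refine ENNReal.ofReal_le_ofReal ?_
    have a1 : (ε / 3) ^ r ≤ ε ^ r / 3 := by
      rw [Real.div_rpow hε.le (by norm_num)]
      gcongr
      calc (3 : ℝ) = 3 ^ (1 : ℝ) := (Real.rpow_one 3).symm
        _ ≤ 3 ^ r := Real.rpow_le_rpow_of_exponent_le (by norm_num) hr
    have a2 : 2 * 2 ^ r * (R ^ (-δ) * K + R ^ (-δ) * K₀) ≤ ε ^ r / 3 := by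
      have := (lt_div_iff₀ (by positivity)).1 hRle
      nlinarith
    have a3 : 2 * 2 ^ r * (R ^ r * ((N + 1) * η)) ≤ ε ^ r / 3 := by
      have := (le_div_iff₀ (by positivity)).1 (min_le_right 1
        (ε ^ r / (3 * (2 * 2 ^ r) * R ^ r * (N + 1))))
      rw [← hη] at this
      linarith
    linarith
  calc wasserstein r P Q ≤ (∫⁻ z, ENNReal.ofReal (|z.1 - z.2| ^ r) ∂γ) ^ (1 / r) :=
        iInf₂_le γ hγ
    _ ≤ ENNReal.ofReal (ε ^ r) ^ (1 / r) := ENNReal.rpow_le_rpow hcost' (by positivity)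
    _ = ENNReal.ofReal ε := by
        rw [ENNReal.ofReal_rpow_of_pos hεr, ← Real.rpow_mul hε.le, mul_one_div_cancel hr0.ne',
          Real.rpow_one]

/-! ### Likelihood ratios, Kullback-Leibler divergence and the evidence -/

lemma lintegral_pi_prod_eq_pow (P : Measure ℝ) [IsProbabilityMeasure P] (n : ℕ) {f : ℝ → ℝ≥0∞}
    (hf : Measurable f) :
    ∫⁻ x, ∏ i, f (x i) ∂(Measure.pi fun _ : Fin n => P) = (∫⁻ y, f y ∂P) ^ n := by
  have hind : iIndepFun (fun (i : Fin n) (x : Fin n → ℝ) => f (x i))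
      (Measure.pi fun _ : Fin n => P) :=
    iIndepFun_pi (μ := fun _ : Fin n => P) (X := fun _ => f) fun _ => hf.aemeasurable
  rw [lintegral_prod_eq_prod_lintegral_of_indepFun Finset.univ _ hind
    fun i => hf.comp (measurable_pi_apply i)]
  have h : ∀ i : Fin n, ∫⁻ x, f (x i) ∂(Measure.pi fun _ : Fin n => P) = ∫⁻ y, f y ∂P :=
    fun i => (measurePreserving_eval (fun _ : Fin n => P) i).lintegral_comp hf
  simp [h]

lemma measurable_likelihoodRatio {F : Set ProbDensity}
    (hF : Measurable (fun q : F × ℝ => (q.1 : ProbDensity) q.2)) (p₀ : ProbDensity) (n : ℕ) :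
    Measurable fun q : F × (Fin n → ℝ) => likelihoodRatio p₀ q.1 q.2 := by
  refine Measurable.coe_nnreal_ennreal (Finset.measurable_prod _ fun i _ => ?_)
  refine Measurable.div ?_ (p₀.measurable_toFun.comp ((measurable_pi_apply i).comp measurable_snd))
  exact hF.comp (measurable_fst.prodMk ((measurable_pi_apply i).comp measurable_snd))

/-- For `t ≥ 1`, `t log t` is `klFun t + (t - 1)`, and the tangent of the convex `klFun` at `exp s`,
which has slope `s`, gives `s (t - 1) ≤ klFun t + s²`. The free `s` is later tuned to the
divergence. -/
lemma mul_max_log_le_klFun {t s : ℝ} (ht : 0 ≤ t) (hs : 0 < s) (hs1 : s ≤ 1) :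
    t * max 0 (Real.log t) ≤ InformationTheory.klFun t * (1 + 1 / s) + s := by
  have hk := InformationTheory.klFun_nonneg ht
  rcases le_total t 1 with h1 | h1
  · rw [max_eq_left (Real.log_nonpos ht h1), mul_zero]
    positivity
  · have ht0 : 0 < t := by linarith
    rw [max_eq_right (Real.log_nonneg h1)]
    have h2 := Real.one_sub_inv_le_log_of_pos (show 0 < t / Real.exp s by positivity)
    rw [Real.log_div ht0.ne' (Real.exp_pos s).ne', Real.log_exp, inv_div] at h2
    have h3 : t - Real.exp s ≤ t * (Real.log t - s) := by
      have := mul_le_mul_of_nonneg_left h2 ht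
      rwa [mul_sub, mul_one, mul_div_cancel₀ _ ht0.ne'] at this
    have h4 := (abs_le.1 (Real.abs_exp_sub_one_sub_id_le (x := s) (by rw [abs_of_pos hs]; exact hs1))).2
    have h5 : s * (t - 1) ≤ InformationTheory.klFun t + s ^ 2 := by
      unfold InformationTheory.klFun; nlinarith
    have h6 : t - 1 ≤ InformationTheory.klFun t / s + s := by
      rw [div_add' _ _ _ hs.ne', le_div_iff₀ hs]; nlinarith
    have h7 : t * Real.log t = InformationTheory.klFun t + (t - 1) := by
      unfold InformationTheory.klFun; ring
    rw [h7, mul_add, mul_one_div, mul_one]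
    linarith

namespace ProbDensity

lemma ae_pos (p : ProbDensity) : ∀ᵐ x ∂p.toMeasure, p x ≠ 0 := by
  rw [toMeasure, ae_withDensity_iff p.measurable_toFun.coe_nnreal_ennreal]
  exact Eventually.of_forall fun x hx => by simpa using hx

lemma lintegral_toMeasure (p : ProbDensity) {f : ℝ → ℝ≥0∞} (hf : Measurable f) :
    ∫⁻ x, f x ∂p.toMeasure = ∫⁻ x, p x * f x :=
  lintegral_withDensity_eq_lintegral_mul _ p.measurable_toFun.coe_nnreal_ennreal hf

lemma ae_eq_mul_rnDeriv {p₀ p : ProbDensity} (hac : p₀.toMeasure ≪ p.toMeasure) :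
    ∀ᵐ x ∂volume, (p₀ x : ℝ≥0∞) = p x * p₀.toMeasure.rnDeriv p.toMeasure x := by
  have h1 := Measure.withDensity_rnDeriv_eq _ _ hac
  conv at h1 => lhs; arg 1; rw [toMeasure]
  rw [← withDensity_mul _ p.measurable_toFun.coe_nnreal_ennreal (Measure.measurable_rnDeriv _ _)]
    at h1
  exact (withDensity_eq_iff_of_sigmaFinite p₀.measurable_toFun.coe_nnreal_ennreal.aemeasurable
    (p.measurable_toFun.coe_nnreal_ennreal.mul
      (Measure.measurable_rnDeriv _ _)).aemeasurable).1 h1.symm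

lemma ae_div_eq_rnDeriv {p₀ p : ProbDensity} (hac : p₀.toMeasure ≪ p.toMeasure) :
    ∀ᵐ x ∂p₀.toMeasure, p x ≠ 0 ∧
      ((p₀ x / p x : ℝ≥0) : ℝ) = (p₀.toMeasure.rnDeriv p.toMeasure x).toReal := by
  have hv : p₀.toMeasure ≪ volume := withDensity_absolutelyContinuous _ _
  filter_upwards [hv.ae_le (ae_eq_mul_rnDeriv hac), hac.ae_le p.ae_pos] with x hx hpx
  refine ⟨hpx, ?_⟩
  have h := congrArg ENNReal.toReal hx
  rw [ENNReal.toReal_mul, ENNReal.coe_toReal, ENNReal.coe_toReal] at h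
  rw [NNReal.coe_div, h, mul_div_cancel_left₀ _ (by exact_mod_cast hpx)]

end ProbDensity

/-- The positive part of the log-likelihood ratio is controlled by the Kullback-Leibler
divergence. -/
lemma lintegral_max_log_le_of_klDiv {p₀ p : ProbDensity} {ε s : ℝ} (hε : 0 < ε) (hs : 0 < s)
    (hs1 : s ≤ 1)
    (h : InformationTheory.klDiv p₀.toMeasure p.toMeasure < ENNReal.ofReal ε) :
    (∀ᵐ x ∂p₀.toMeasure, p x ≠ 0) ∧
    ∫⁻ x, ENNReal.ofReal (max 0 (Real.log ((p₀ x / p x : ℝ≥0) : ℝ))) ∂p₀.toMeasure ≤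
      ENNReal.ofReal (ε * (1 + 1 / s) + s) := by
  have hac : p₀.toMeasure ≪ p.toMeasure := by
    by_contra hac
    rw [InformationTheory.klDiv_of_not_ac hac] at h
    exact absurd h (by simp)
  rw [InformationTheory.klDiv_eq_lintegral_klFun_of_ac hac] at h
  have hae := ProbDensity.ae_div_eq_rnDeriv hac
  refine ⟨hae.mono fun x hx => hx.1, ?_⟩
  have hfm : Measurable fun x => (p₀.toMeasure.rnDeriv p.toMeasure x).toReal :=
    (Measure.measurable_rnDeriv _ _).ennreal_toReal
  have hkm : Measurable InformationTheory.klFun := InformationTheory.measurable_klFun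
  calc ∫⁻ x, ENNReal.ofReal (max 0 (Real.log ((p₀ x / p x : ℝ≥0) : ℝ))) ∂p₀.toMeasure
      = ∫⁻ x, ENNReal.ofReal (max 0 (Real.log (p₀.toMeasure.rnDeriv p.toMeasure x).toReal))
          ∂p₀.toMeasure :=
        lintegral_congr_ae (hae.mono fun x hx => by simp only [hx.2])
    -- Integrating against `P` instead of `P₀` brings in the density factor `t` and meets the form
    -- of the divergence as the integral of `klFun`.
    _ = ∫⁻ x, p₀.toMeasure.rnDeriv p.toMeasure x *
          ENNReal.ofReal (max 0 (Real.log (p₀.toMeasure.rnDeriv p.toMeasure x).toReal))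
          ∂p.toMeasure := by
        rw [lintegral_rnDeriv_mul hac]
        exact (ENNReal.measurable_ofReal.comp
          (measurable_const.max (Real.measurable_log.comp hfm))).aemeasurable
    _ ≤ ∫⁻ x, (ENNReal.ofReal
          (InformationTheory.klFun (p₀.toMeasure.rnDeriv p.toMeasure x).toReal) *
          ENNReal.ofReal (1 + 1 / s) + ENNReal.ofReal s) ∂p.toMeasure := by
        refine lintegral_mono_ae ?_
        filter_upwards [Measure.rnDeriv_ne_top p₀.toMeasure p.toMeasure] with x hx
        conv_lhs => rw [← ENNReal.ofReal_toReal hx]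
        have h0 : 0 ≤ (p₀.toMeasure.rnDeriv p.toMeasure x).toReal := ENNReal.toReal_nonneg
        rw [ENNReal.toReal_ofReal h0, ← ENNReal.ofReal_mul h0,
          ← ENNReal.ofReal_mul (InformationTheory.klFun_nonneg h0),
          ← ENNReal.ofReal_add (mul_nonneg (InformationTheory.klFun_nonneg h0) (by positivity))
            hs.le]
        exact ENNReal.ofReal_le_ofReal (mul_max_log_le_klFun h0 hs hs1)
    _ ≤ _ := by
        have hkfm : Measurable fun x => ENNReal.ofReal
            (InformationTheory.klFun (p₀.toMeasure.rnDeriv p.toMeasure x).toReal) :=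
          ENNReal.measurable_ofReal.comp (hkm.comp hfm)
        rw [lintegral_add_right _ measurable_const, lintegral_mul_const _ hkfm, lintegral_const, measure_univ, mul_one,
          ENNReal.ofReal_add (by positivity) hs.le, ENNReal.ofReal_mul hε.le]
        gcongr

/-- Markov's inequality for the sum of the positive parts of `log (p₀ / p)`: its mean is `n` times
the one-variable mean, and the `n` cancels. No law of large numbers is needed. -/
lemma measure_likelihoodRatio_lt_le {p₀ p : ProbDensity} {c : ℝ} (hc : 0 < c) {n : ℕ} (hn : n ≠ 0)
    (hp : ∀ᵐ x ∂p₀.toMeasure, p x ≠ 0) :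
    (Measure.pi fun _ : Fin n => p₀.toMeasure)
        {x | likelihoodRatio p₀ p x < ENNReal.ofReal (Real.exp (-(n * c)))} ≤
      (∫⁻ x, ENNReal.ofReal (max 0 (Real.log ((p₀ x / p x : ℝ≥0) : ℝ))) ∂p₀.toMeasure) /
        ENNReal.ofReal c := by
  set ℓ : ℝ → ℝ := fun x => max 0 (Real.log ((p₀ x / p x : ℝ≥0) : ℝ)) with hℓ
  have hℓm : Measurable ℓ := measurable_const.max (Real.measurable_log.comp
    (measurable_coe_nnreal_real.comp (p₀.measurable_toFun.div p.measurable_toFun)))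
  have hn0 : (0 : ℝ) < n := by exact_mod_cast Nat.pos_of_ne_zero hn
  have hgood : ∀ᵐ x ∂(Measure.pi fun _ : Fin n => p₀.toMeasure),
      ∀ i, p (x i) ≠ 0 ∧ p₀ (x i) ≠ 0 := by
    rw [ae_all_iff]
    exact fun i => (measurePreserving_eval (fun _ : Fin n => p₀.toMeasure) i).quasiMeasurePreserving.ae
      (hp.and p₀.ae_pos)
  have hsub : {x | likelihoodRatio p₀ p x < ENNReal.ofReal (Real.exp (-(n * c)))}
      ≤ᵐ[Measure.pi fun _ : Fin n => p₀.toMeasure]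
      {x | ENNReal.ofReal (n * c) ≤ ∑ i, ENNReal.ofReal (ℓ (x i))} := by
    filter_upwards [hgood] with x hx hlt
    change likelihoodRatio p₀ p x < ENNReal.ofReal (Real.exp (-(n * c))) at hlt
    change ENNReal.ofReal (n * c) ≤ ∑ i, ENNReal.ofReal (ℓ (x i))
    rw [← ENNReal.ofReal_sum_of_nonneg fun i _ => le_max_left _ _]
    refine ENNReal.ofReal_le_ofReal ?_
    rw [likelihoodRatio, ← ENNReal.ofReal_coe_nnreal,
      ENNReal.ofReal_lt_ofReal_iff (Real.exp_pos _), NNReal.coe_prod] at hlt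
    have h1 : Real.exp (-∑ i, ℓ (x i)) ≤ ∏ i, ((p (x i) / p₀ (x i) : ℝ≥0) : ℝ) := by
      rw [← Finset.sum_neg_distrib, Real.exp_sum]
      refine Finset.prod_le_prod (fun i _ => (Real.exp_pos _).le) fun i _ => ?_
      have hpos : (0 : ℝ) < ((p₀ (x i) / p (x i) : ℝ≥0) : ℝ) := by
        have := div_pos (pos_iff_ne_zero.2 (hx i).2) (pos_iff_ne_zero.2 (hx i).1)
        exact_mod_cast this
      calc Real.exp (-ℓ (x i)) ≤ Real.exp (-Real.log ((p₀ (x i) / p (x i) : ℝ≥0) : ℝ)) :=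
            Real.exp_le_exp.2 (neg_le_neg (le_max_right _ _))
        _ = _ := by
            rw [Real.exp_neg, Real.exp_log hpos, ← NNReal.coe_inv, inv_div]
    have := Real.exp_lt_exp.1 (h1.trans_lt hlt)
    linarith
  refine (measure_mono_ae hsub).trans ?_
  have hsum : ∫⁻ x, ∑ i, ENNReal.ofReal (ℓ (x i)) ∂(Measure.pi fun _ : Fin n => p₀.toMeasure) =
      n * ∫⁻ x, ENNReal.ofReal (ℓ x) ∂p₀.toMeasure := by
    rw [lintegral_finsetSum _ fun i _ => by fun_prop]
    have h : ∀ i : Fin n, ∫⁻ x, ENNReal.ofReal (ℓ (x i)) ∂(Measure.pi fun _ : Fin n => p₀.toMeasure)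
        = ∫⁻ y, ENNReal.ofReal (ℓ y) ∂p₀.toMeasure := fun i =>
      (measurePreserving_eval (fun _ : Fin n => p₀.toMeasure) i).lintegral_comp
        (f := fun y => ENNReal.ofReal (ℓ y)) (by fun_prop)
    simp [h]
  refine (meas_ge_le_lintegral_div (Measurable.aemeasurable (by fun_prop))
    (ENNReal.ofReal_pos.2 (by positivity)).ne' ENNReal.ofReal_ne_top).trans ?_
  rw [hsum, ENNReal.ofReal_mul hn0.le, ENNReal.ofReal_natCast,
    ENNReal.mul_div_mul_left _ _ (by exact_mod_cast hn) (ENNReal.natCast_ne_top n)]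

/-- The marginal likelihood is not exponentially small. -/
lemma eventually_measure_evidence_lt_le {F : Set ProbDensity}
    (hF : Measurable (fun q : F × ℝ => (q.1 : ProbDensity) q.2))
    (Pr : ℕ → Measure F) [∀ n, IsProbabilityMeasure (Pr n)] (p₀ : ProbDensity)
    (hKL : KLSupport Pr p₀) {c κ : ℝ} (hc : 0 < c) (hκ : 0 < κ) :
    ∃ ρ : ℝ, 0 < ρ ∧ ∀ᶠ n in atTop, (Measure.pi fun _ : Fin n => p₀.toMeasure)
      {x | ∫⁻ p, likelihoodRatio p₀ p x ∂(Pr n) < ENNReal.ofReal (ρ * Real.exp (-(n * c)))} ≤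
        ENNReal.ofReal κ := by
  -- Divergence below `s²` bounds the mean positive part by `s² + 2s ≤ 3s`.
  obtain ⟨s, hs, hs1, hsκ⟩ : ∃ s : ℝ, 0 < s ∧ s ≤ 1 ∧ 3 * s ≤ κ / 2 * c :=
    ⟨min 1 (κ / 2 * c / 3), by positivity, min_le_left _ _, by
      linarith [min_le_right 1 (κ / 2 * c / 3)]⟩
  have hbad : ∀ p : F, ∀ n : ℕ, n ≠ 0 →
      InformationTheory.klDiv p₀.toMeasure (p : ProbDensity).toMeasure < ENNReal.ofReal (s ^ 2) →
      (Measure.pi fun _ : Fin n => p₀.toMeasure)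
        {x | likelihoodRatio p₀ p x < ENNReal.ofReal (Real.exp (-(n * c)))} ≤
        ENNReal.ofReal (κ / 2) := by
    intro p n hn hp
    obtain ⟨h1, h2⟩ := lintegral_max_log_le_of_klDiv (by positivity) hs hs1 hp
    refine (measure_likelihoodRatio_lt_le hc hn h1).trans ?_
    refine ENNReal.div_le_of_le_mul (h2.trans ?_)
    rw [← ENNReal.ofReal_mul (by positivity)]
    refine ENNReal.ofReal_le_ofReal ?_
    have : s ^ 2 * (1 + 1 / s) + s = s ^ 2 + 2 * s := by field_simp; ring
    rw [this]
    nlinarith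
  have hlim := hKL (s ^ 2) (by positivity)
  obtain ⟨ρ₀, hρ₀, hρ₀lim⟩ := exists_between hlim
  have hρtop : ρ₀ ≠ ∞ := hρ₀lim.ne_top
  refine ⟨ρ₀.toReal / 2, half_pos (ENNReal.toReal_pos hρ₀.ne' hρtop), ?_⟩
  filter_upwards [eventually_lt_of_lt_liminf hρ₀lim, eventually_ne_atTop 0] with n hn hn0
  set π := Measure.pi fun _ : Fin n => p₀.toMeasure with hπ
  set t := ENNReal.ofReal (Real.exp (-(n * c))) with ht
  have hLR := measurable_likelihoodRatio hF p₀ n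
  have hS : MeasurableSet {q : F × (Fin n → ℝ) | likelihoodRatio p₀ q.1 q.2 < t} :=
    measurableSet_lt hLR measurable_const
  -- `B` contains the Kullback-Leibler ball, and its measurability follows from joint measurability
  -- alone.
  set B : Set F := {p | π {x | likelihoodRatio p₀ p x < t} ≤ ENNReal.ofReal (κ / 2)} with hB
  have hBm : MeasurableSet B := measurableSet_le (measurable_measure_prodMk_left hS)
    measurable_const
  have hBρ : ρ₀ < Pr n B := hn.trans_le (measure_mono fun p hp => hbad p n hn0 hp)
  set ν := (Pr n).restrict B with hν
  have hνB : ν Set.univ = Pr n B := by simp [hν]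
  have hB0 : Pr n B ≠ 0 := (hρ₀.trans hBρ).ne'
  have hBt : Pr n B ≠ ∞ := measure_ne_top _ _
  have hfub : ∫⁻ x, ν {p | likelihoodRatio p₀ p x < t} ∂π ≤ ENNReal.ofReal (κ / 2) * Pr n B := by
    calc ∫⁻ x, ν {p | likelihoodRatio p₀ p x < t} ∂π
        = (ν.prod π) {q : F × (Fin n → ℝ) | likelihoodRatio p₀ q.1 q.2 < t} :=
          (Measure.prod_apply_symm hS).symm
      _ = ∫⁻ p in B, π {x | likelihoodRatio p₀ p x < t} ∂(Pr n) := Measure.prod_apply hS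
      _ ≤ ∫⁻ _ in B, ENNReal.ofReal (κ / 2) ∂(Pr n) := setLIntegral_mono' hBm fun p hp => hp
      _ = _ := setLIntegral_const _ _
  -- Fubini and a second Markov bound: off an event of probability at most `κ`, at least half of the
  -- prior mass of `B` has likelihood ratio at least `t`.
  have hmarkov : π {x | Pr n B / 2 ≤ ν {p | likelihoodRatio p₀ p x < t}} ≤ ENNReal.ofReal κ := by
    refine (meas_ge_le_lintegral_div (measurable_measure_prodMk_right hS).aemeasurable
      (by simpa using hB0) (ENNReal.div_ne_top hBt (by simp))).trans ?_
    refine ENNReal.div_le_of_le_mul (hfub.trans (le_of_eq ?_))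
    rw [show κ = κ / 2 * 2 by ring, ENNReal.ofReal_mul (by positivity), mul_div_assoc,
      mul_assoc]
    norm_num
    rw [ENNReal.mul_div_cancel (by simp) (by simp)]
  refine (measure_mono fun x hx => ?_).trans hmarkov
  by_contra hlt
  rw [Set.mem_ofPred_eq, not_le] at hlt
  rw [Set.mem_ofPred_eq] at hx
  refine not_le.2 hx ?_
  have hx_meas : MeasurableSet {p : F | likelihoodRatio p₀ p x < t} := measurable_prodMk_right hS
  have hgood : Pr n B / 2 ≤ ν {p | t ≤ likelihoodRatio p₀ p x} := by
    have hadd := measure_add_measure_compl (μ := ν) hx_meas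
    rw [hνB, show {p : F | likelihoodRatio p₀ p x < t}ᶜ = {p : F | t ≤ likelihoodRatio p₀ p x} by
      ext p; simp] at hadd
    by_contra! hgt
    have := ENNReal.add_lt_add hlt hgt
    rw [hadd, ENNReal.add_halves] at this
    exact lt_irrefl _ this
  calc ENNReal.ofReal (ρ₀.toReal / 2 * Real.exp (-(n * c))) = t * (ρ₀ / 2) := by
        rw [ENNReal.ofReal_mul (by positivity), mul_comm,
          ENNReal.ofReal_div_of_pos two_pos, ENNReal.ofReal_toReal hρtop]
        simp [ht]
    _ ≤ t * ν {p | t ≤ likelihoodRatio p₀ p x} := by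
        gcongr
        exact (ENNReal.div_le_div_right hBρ.le _).trans hgood
    _ ≤ ∫⁻ p, likelihoodRatio p₀ p x ∂ν :=
        mul_meas_ge_le_lintegral (hLR.comp measurable_prodMk_right) t
    _ ≤ ∫⁻ p, likelihoodRatio p₀ p x ∂(Pr n) := setLIntegral_le_lintegral _ _

/-! ### Chernoff bounds and testing by the frequency of one event -/

/-- With `a = P(C) ≤ 1`, the integral is `1 + a (exp t - 1) ≤ 1 + a t + t² ≤ exp (a t + t²)`. -/
lemma lintegral_exp_indicator_le (P : Measure ℝ) [IsProbabilityMeasure P] {C : Set ℝ}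
    (hC : MeasurableSet C) {t : ℝ} (ht : |t| ≤ 1) :
    ∫⁻ y, ENNReal.ofReal (Real.exp (t * C.indicator 1 y)) ∂P ≤
      ENNReal.ofReal (Real.exp (t * P.real C + t ^ 2)) := by
  have ha0 : 0 ≤ P.real C := measureReal_nonneg
  have ha1 : P.real C ≤ 1 := measureReal_le_one
  have h1 : ∫⁻ y in C, ENNReal.ofReal (Real.exp (t * C.indicator 1 y)) ∂P =
      ENNReal.ofReal (Real.exp t) * P C := by
    rw [← setLIntegral_const]
    exact setLIntegral_congr_fun hC fun y hy => by simp [hy]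
  have h2 : ∫⁻ y in Cᶜ, ENNReal.ofReal (Real.exp (t * C.indicator 1 y)) ∂P = P Cᶜ := by
    rw [← setLIntegral_one]
    exact setLIntegral_congr_fun hC.compl fun y hy => by
      simp [Set.indicator_of_notMem (show y ∉ C from hy)]
  rw [← lintegral_add_compl _ hC, h1, h2, ← ofReal_measureReal (μ := P) (s := C),
    ← ofReal_measureReal (μ := P) (s := Cᶜ), ← ENNReal.ofReal_mul (Real.exp_pos _).le,
    ← ENNReal.ofReal_add (by positivity) measureReal_nonneg, probReal_compl_eq_one_sub hC]
  refine ENNReal.ofReal_le_ofReal ?_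
  have h3 := (abs_le.1 (Real.abs_exp_sub_one_sub_id_le ht)).2
  have h4 := Real.add_one_le_exp (t * P.real C + t ^ 2)
  nlinarith [sq_nonneg t]

lemma measurable_sum_indicator {C : Set ℝ} (hC : MeasurableSet C) (n : ℕ) :
    Measurable fun x : Fin n → ℝ => ∑ i, C.indicator (1 : ℝ → ℝ) (x i) :=
  Finset.measurable_sum _ fun i _ =>
    (measurable_one.indicator hC).comp (measurable_pi_apply i)

lemma measurable_exp_indicator {C : Set ℝ} (hC : MeasurableSet C) (t : ℝ) :
    Measurable fun y : ℝ => ENNReal.ofReal (Real.exp (t * C.indicator 1 y)) :=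
  ENNReal.measurable_ofReal.comp
    (Real.measurable_exp.comp ((measurable_one.indicator hC).const_mul t))

lemma ofReal_exp_sum_indicator (C : Set ℝ) (t : ℝ) {n : ℕ} (x : Fin n → ℝ) :
    ENNReal.ofReal (Real.exp (t * ∑ i, C.indicator 1 (x i))) =
      ∏ i, ENNReal.ofReal (Real.exp (t * C.indicator 1 (x i))) := by
  rw [Finset.mul_sum, Real.exp_sum, ENNReal.ofReal_prod_of_nonneg fun i _ => (Real.exp_pos _).le]

lemma ofReal_exp_mul_pow_le {b u v : ℝ} {I : ℝ≥0∞} {n : ℕ} (hI : I ≤ ENNReal.ofReal (Real.exp b))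
    (huv : u + n * b ≤ v) :
    ENNReal.ofReal (Real.exp u) * I ^ n ≤ ENNReal.ofReal (Real.exp v) := by
  calc ENNReal.ofReal (Real.exp u) * I ^ n
      ≤ ENNReal.ofReal (Real.exp u) * ENNReal.ofReal (Real.exp b) ^ n := by gcongr
    _ = ENNReal.ofReal (Real.exp (u + n * b)) := by
        rw [← ENNReal.ofReal_pow (Real.exp_pos _).le, ← ENNReal.ofReal_mul (Real.exp_pos _).le,
          ← Real.exp_nat_mul, ← Real.exp_add]
    _ ≤ _ := ENNReal.ofReal_le_ofReal (Real.exp_le_exp.2 huv)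

/-- Chernoff's bound at `t = η / 4`, with exponent per observation `-η²/8 + η²/16`. -/
lemma measure_le_sum_indicator_le (P : Measure ℝ) [IsProbabilityMeasure P] {C : Set ℝ}
    (hC : MeasurableSet C) {η : ℝ} (hη : 0 < η) (hη1 : η ≤ 1) (n : ℕ) :
    (Measure.pi fun _ : Fin n => P)
        {x | n * (P.real C + η / 2) ≤ ∑ i, C.indicator (1 : ℝ → ℝ) (x i)} ≤
      ENNReal.ofReal (Real.exp (-(n * (η ^ 2 / 16)))) := by
  set u := η / 4 * (n * (P.real C + η / 2)) with hu
  have hsub : {x : Fin n → ℝ | n * (P.real C + η / 2) ≤ ∑ i, C.indicator (1 : ℝ → ℝ) (x i)} ⊆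
      {x | 1 ≤ ENNReal.ofReal (Real.exp (-u)) *
        ∏ i, ENNReal.ofReal (Real.exp (η / 4 * C.indicator 1 (x i)))} := by
    intro x hx
    change 1 ≤ ENNReal.ofReal (Real.exp (-u)) *
        ∏ i, ENNReal.ofReal (Real.exp (η / 4 * C.indicator 1 (x i)))
    rw [← ofReal_exp_sum_indicator, ← ENNReal.ofReal_mul (Real.exp_pos _).le, ← Real.exp_add]
    refine ENNReal.one_le_ofReal.2 (Real.one_le_exp ?_)
    have := mul_le_mul_of_nonneg_left (show _ ≤ _ from hx) (show 0 ≤ η / 4 by positivity)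
    linarith
  have hm : Measurable fun x : Fin n → ℝ =>
      ∏ i, ENNReal.ofReal (Real.exp (η / 4 * C.indicator 1 (x i))) :=
    Finset.measurable_prod _ fun i _ =>
      (measurable_exp_indicator hC _).comp (measurable_pi_apply i)
  refine (measure_mono hsub).trans ((meas_ge_le_lintegral_div (hm.const_mul _).aemeasurable
    one_ne_zero ENNReal.one_ne_top).trans ?_)
  rw [div_one, lintegral_const_mul _ hm, lintegral_pi_prod_eq_pow P n (measurable_exp_indicator hC _)]
  refine ofReal_exp_mul_pow_le (lintegral_exp_indicator_le P hC
    (by rw [abs_of_pos (by positivity)]; linarith)) (le_of_eq ?_)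
  rw [hu]; ring

/-- The other error of the test: the weight is at least 1 where the frequency of `C` is at most
`P₀(C) + η/2`, and the likelihood ratio moves the integral to the law `P`, under which so low a
frequency is exponentially rare. -/
lemma lintegral_likelihoodRatio_mul_exp_le {p₀ p : ProbDensity} {C : Set ℝ}
    (hC : MeasurableSet C) {η : ℝ} (hη : 0 < η) (hη1 : η ≤ 1)
    (hp : p₀.toMeasure.real C + η ≤ p.toMeasure.real C) (n : ℕ) :
    ∫⁻ x, likelihoodRatio p₀ p x * ENNReal.ofReal (Real.exp
        (η / 4 * (n * (p₀.toMeasure.real C + η / 2)) +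
          -(η / 4) * ∑ i, C.indicator (1 : ℝ → ℝ) (x i)))
        ∂(Measure.pi fun _ : Fin n => p₀.toMeasure) ≤
      ENNReal.ofReal (Real.exp (-(n * (η ^ 2 / 16)))) := by
  set u := η / 4 * (n * (p₀.toMeasure.real C + η / 2)) with hu
  let g : ℝ → ℝ≥0∞ := fun y => ((p y / p₀ y : ℝ≥0) : ℝ≥0∞) *
    ENNReal.ofReal (Real.exp (-(η / 4) * C.indicator 1 y))
  have hgm : Measurable g := (p.measurable_toFun.div p₀.measurable_toFun).coe_nnreal_ennreal.mul
    (measurable_exp_indicator hC _)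
  have heq : ∀ x : Fin n → ℝ, likelihoodRatio p₀ p x * ENNReal.ofReal (Real.exp
        (u + -(η / 4) * ∑ i, C.indicator (1 : ℝ → ℝ) (x i))) =
      ENNReal.ofReal (Real.exp u) * ∏ i, g (x i) := by
    intro x
    rw [Real.exp_add, ENNReal.ofReal_mul (Real.exp_pos _).le, ofReal_exp_sum_indicator,
      Finset.prod_mul_distrib, likelihoodRatio, ENNReal.ofNNReal_finsetProd]
    ring
  simp_rw [heq]
  have hgprod : Measurable fun x : Fin n → ℝ => ∏ i, g (x i) :=
    Finset.measurable_prod _ fun i _ => hgm.comp (measurable_pi_apply i)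
  rw [lintegral_const_mul _ hgprod, lintegral_pi_prod_eq_pow _ n hgm]
  have hg : ∫⁻ y, g y ∂p₀.toMeasure ≤
      ENNReal.ofReal (Real.exp (-(η / 4) * p.toMeasure.real C + (-(η / 4)) ^ 2)) := by
    refine le_trans ?_ (lintegral_exp_indicator_le p.toMeasure hC (t := -(η / 4))
      (by rw [abs_neg, abs_of_pos (by positivity)]; linarith))
    rw [p₀.lintegral_toMeasure hgm, p.lintegral_toMeasure (measurable_exp_indicator hC _)]
    refine lintegral_mono fun y => ?_
    simp only [g]
    rw [← mul_assoc, ← ENNReal.coe_mul]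
    gcongr
    -- Where `p₀` vanishes the ratio is `0` by convention, so mass of `P` may be lost; an inequality
    -- is enough.
    by_cases h0 : p₀ y = 0
    · simp [h0]
    · rw [mul_div_cancel₀ _ h0]
  refine ofReal_exp_mul_pow_le hg ?_
  have := mul_le_mul_of_nonneg_left hp (show 0 ≤ (n : ℝ) * (η / 4) by positivity)
  rw [hu]
  nlinarith

/-- The posterior mass of a set of densities that are separated from the truth by the probability
of a single event tends to zero. -/
lemma tendsto_measure_le_posteriorProb {F : Set ProbDensity}
    (hF : Measurable (fun q : F × ℝ => (q.1 : ProbDensity) q.2))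
    (Pr : ℕ → Measure F) [∀ n, IsProbabilityMeasure (Pr n)] (p₀ : ProbDensity)
    (hKL : KLSupport Pr p₀) {C : Set ℝ} (hC : MeasurableSet C) {η : ℝ} (hη : 0 < η) (hη1 : η ≤ 1)
    {A : Set F} (hA : MeasurableSet A)
    (hAC : ∀ p ∈ A, p₀.toMeasure.real C + η ≤ (p : ProbDensity).toMeasure.real C)
    {κ : ℝ} (hκ : 0 < κ) :
    Tendsto (fun n => (Measure.pi fun _ : Fin n => p₀.toMeasure)
      {x | ENNReal.ofReal κ ≤ posteriorProb (Pr n) p₀ x A}) atTop (𝓝 0) := by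
  rw [ENNReal.tendsto_nhds_zero]
  intro ε hε
  obtain ⟨τ, hτ, hτε⟩ := ENNReal.lt_iff_exists_nnreal_btwn.1 hε
  have hτ0 : (0 : ℝ) < τ := by exact_mod_cast hτ
  -- Half the exponent of the tests, so that the numerator still beats the evidence by a factor `exp
  -- (-(n * c))`.
  set c := η ^ 2 / 32 with hc
  have hc0 : 0 < c := by positivity
  obtain ⟨ρ, hρ, hev⟩ := eventually_measure_evidence_lt_le hF Pr p₀ hKL hc0
    (show 0 < (τ : ℝ) / 3 by positivity)
  have hexp : Tendsto (fun n : ℕ => Real.exp (-(n * c))) atTop (𝓝 0) :=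
    Real.tendsto_exp_neg_atTop_nhds_zero.comp
      (tendsto_natCast_atTop_atTop.atTop_mul_const hc0)
  filter_upwards [hev, hexp.eventually_le_const (show 0 < (τ : ℝ) / 3 by positivity),
    hexp.eventually_le_const (show 0 < (τ : ℝ) / 3 * (κ * ρ) by positivity)] with n h1 h2 h3
  set π := Measure.pi fun _ : Fin n => p₀.toMeasure with hπ
  set a := p₀.toMeasure.real C with ha
  let w : (Fin n → ℝ) → ℝ≥0∞ := fun x => ENNReal.ofReal (Real.exp
    (η / 4 * (n * (a + η / 2)) + -(η / 4) * ∑ i, C.indicator (1 : ℝ → ℝ) (x i)))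
  have hw : Measurable w := ENNReal.measurable_ofReal.comp (Real.measurable_exp.comp
    (measurable_const.add ((measurable_sum_indicator hC n).const_mul _)))
  let T : (Fin n → ℝ) → ℝ≥0∞ := fun x => ∫⁻ p in A, likelihoodRatio p₀ p x * w x ∂(Pr n)
  have hjoint : Measurable fun q : F × (Fin n → ℝ) => likelihoodRatio p₀ q.1 q.2 * w q.2 :=
    (measurable_likelihoodRatio hF p₀ n).mul (hw.comp measurable_snd)
  have hT : Measurable T := hjoint.lintegral_prod_left'
  have hexp2 : Real.exp (-(n * (η ^ 2 / 16))) = Real.exp (-(n * c)) * Real.exp (-(n * c)) := by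
    rw [← Real.exp_add, hc]; ring_nf
  have hTint : ∫⁻ x, T x ∂π ≤ ENNReal.ofReal (Real.exp (-(n * c)) * Real.exp (-(n * c))) := by
    rw [← hexp2]
    calc ∫⁻ x, T x ∂π = ∫⁻ p in A, ∫⁻ x, likelihoodRatio p₀ p x * w x ∂π ∂(Pr n) :=
          (lintegral_lintegral_swap hjoint.aemeasurable).symm
      _ ≤ ∫⁻ _ in A, ENNReal.ofReal (Real.exp (-(n * (η ^ 2 / 16)))) ∂(Pr n) :=
          setLIntegral_mono' hA fun p hp =>
            lintegral_likelihoodRatio_mul_exp_le hC hη hη1 (hAC p hp) n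
      _ ≤ _ := by
          rw [setLIntegral_const]
          exact mul_le_of_le_one_right zero_le prob_le_one
  -- Three ways to fail: small evidence, a large frequency of `C`, or a large weighted numerator
  -- `T`. Each gets probability at most `τ / 3`.
  have hsub : {x | ENNReal.ofReal κ ≤ posteriorProb (Pr n) p₀ x A} ⊆
      ({x | ∫⁻ p, likelihoodRatio p₀ p x ∂(Pr n) < ENNReal.ofReal (ρ * Real.exp (-(n * c)))} ∪
        {x | n * (a + η / 2) ≤ ∑ i, C.indicator (1 : ℝ → ℝ) (x i)}) ∪
        {x | ENNReal.ofReal (κ * (ρ * Real.exp (-(n * c)))) ≤ T x} := by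
    intro x hx
    by_contra hnot
    simp only [Set.mem_union, Set.mem_ofPred_eq, not_or, not_lt, not_le] at hnot
    obtain ⟨⟨hD, hS⟩, hN⟩ := hnot
    refine absurd hN (not_lt.2 ?_)
    calc ENNReal.ofReal (κ * (ρ * Real.exp (-(n * c))))
        = ENNReal.ofReal κ * ENNReal.ofReal (ρ * Real.exp (-(n * c))) :=
          ENNReal.ofReal_mul hκ.le
      _ ≤ ENNReal.ofReal κ * ∫⁻ p, likelihoodRatio p₀ p x ∂(Pr n) := by gcongr
      _ ≤ ∫⁻ p in A, likelihoodRatio p₀ p x ∂(Pr n) := ENNReal.mul_le_of_le_div hx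
      _ ≤ T x := by
          refine lintegral_mono fun p => le_mul_of_one_le_right zero_le ?_
          refine ENNReal.one_le_ofReal.2 (Real.one_le_exp ?_)
          have := mul_le_mul_of_nonneg_left hS.le (show 0 ≤ η / 4 by positivity)
          linarith
  refine (measure_mono hsub).trans (le_trans ?_ hτε.le)
  refine (measure_union_le _ _).trans ((add_le_add (measure_union_le _ _) le_rfl).trans ?_)
  have e2 := (measure_le_sum_indicator_le p₀.toMeasure hC hη hη1 n).trans
    (ENNReal.ofReal_le_ofReal (show _ ≤ (τ : ℝ) / 3 by
      rw [hexp2]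
      have : Real.exp (-(n * c)) ≤ 1 := Real.exp_le_one_iff.2 (by
        have : 0 ≤ (n : ℝ) * c := by positivity
        linarith)
      nlinarith [Real.exp_pos (-(n * c))]))
  have e3 : π {x | ENNReal.ofReal (κ * (ρ * Real.exp (-(n * c)))) ≤ T x} ≤
      ENNReal.ofReal ((τ : ℝ) / 3) := by
    refine (meas_ge_le_lintegral_div hT.aemeasurable
      (ENNReal.ofReal_pos.2 (by positivity)).ne' ENNReal.ofReal_ne_top).trans ?_
    refine ENNReal.div_le_of_le_mul (hTint.trans ?_)
    rw [← ENNReal.ofReal_mul (by positivity)]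
    refine ENNReal.ofReal_le_ofReal ?_
    have := mul_le_mul_of_nonneg_right h3 (Real.exp_pos (-(n * c))).le
    linarith
  refine (add_le_add (add_le_add h1 e2) e3).trans (le_of_eq ?_)
  rw [← ENNReal.ofReal_add (by positivity) (by positivity),
    ← ENNReal.ofReal_add (by positivity) (by positivity), add_thirds, ENNReal.ofReal_coe_nnreal]

/-! ### Calculus of posterior probabilities, and the conclusion -/

lemma posteriorProb_mono {F : Set ProbDensity} (Pr : Measure F) (p₀ : ProbDensity) {n : ℕ}
    (x : Fin n → ℝ) {A B : Set F} (h : A ⊆ B) :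
    posteriorProb Pr p₀ x A ≤ posteriorProb Pr p₀ x B :=
  ENNReal.div_le_div_right (lintegral_mono_set h) _

lemma posteriorProb_le_one {F : Set ProbDensity} (Pr : Measure F) (p₀ : ProbDensity) {n : ℕ}
    (x : Fin n → ℝ) (A : Set F) : posteriorProb Pr p₀ x A ≤ 1 :=
  (ENNReal.div_le_div_right (setLIntegral_le_lintegral _ _) _).trans ENNReal.div_self_le_one

lemma posteriorProb_union_le {F : Set ProbDensity} (Pr : Measure F) (p₀ : ProbDensity) {n : ℕ}
    (x : Fin n → ℝ) (A B : Set F) :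
    posteriorProb Pr p₀ x (A ∪ B) ≤ posteriorProb Pr p₀ x A + posteriorProb Pr p₀ x B := by
  rw [posteriorProb, posteriorProb, posteriorProb, ENNReal.div_add_div_same]
  exact ENNReal.div_le_div_right (lintegral_union_le _ _ _) _

lemma posteriorProb_iUnion_le {F : Set ProbDensity} (Pr : Measure F) (p₀ : ProbDensity) {n : ℕ}
    (x : Fin n → ℝ) {κ : Type*} [Fintype κ] (A : κ → Set F) :
    posteriorProb Pr p₀ x (⋃ k, A k) ≤ ∑ k, posteriorProb Pr p₀ x (A k) := by
  simp only [posteriorProb, div_eq_mul_inv, ← Finset.sum_mul]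
  gcongr
  refine (lintegral_iUnion_le _ _).trans (le_of_eq ?_)
  rw [tsum_fintype]

/-- Equality can fail, since the quotients are `0` when the evidence is `0` or `∞`. -/
lemma posteriorProb_add_compl_le {F : Set ProbDensity} (Pr : Measure F) (p₀ : ProbDensity) {n : ℕ}
    (x : Fin n → ℝ) {A : Set F} (hA : MeasurableSet A) :
    posteriorProb Pr p₀ x A + posteriorProb Pr p₀ x Aᶜ ≤ 1 := by
  rw [posteriorProb, posteriorProb, ENNReal.div_add_div_same, lintegral_add_compl _ hA]
  exact ENNReal.div_self_le_one

lemma measurable_lintegral_toMeasure {F : Set ProbDensity}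
    (hF : Measurable (fun q : F × ℝ => (q.1 : ProbDensity) q.2)) {f : ℝ → ℝ≥0∞}
    (hf : Measurable f) :
    Measurable fun p : F => ∫⁻ x, f x ∂(p : ProbDensity).toMeasure := by
  simp_rw [fun p : F => (p : ProbDensity).lintegral_toMeasure hf]
  exact (hF.coe_nnreal_ennreal.mul (hf.comp measurable_snd)).lintegral_prod_right'

theorem mainTheorem3
    -- the family of densities, and the priors, which may depend on the sample size
    (F : Set ProbDensity)
    (hF : Measurable (fun q : F × ℝ => (q.1 : ProbDensity) q.2))
    (Pr : ℕ → Measure F) [∀ n, IsProbabilityMeasure (Pr n)]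
    -- the true density and the i.i.d. observations
    (p₀ : ProbDensity)
    {Ω : Type*} [MeasurableSpace Ω] (μ : Measure Ω) [IsProbabilityMeasure μ]
    (X : ℕ → Ω → ℝ) (hXlaw : ∀ i, HasLaw (X i) p₀.toMeasure μ) (hXindep : iIndepFun X μ)
    (r : ℝ) (hr : 1 ≤ r)
    (hKL : KLSupport Pr p₀)
    (K δ : ℝ) (hK : 0 < K) (hδ : 0 < δ)
    (hmoment : absMoment (r + δ) p₀.toMeasure < ∞)
    (hpost : TendstoInMeasure μ
      (fun n ω => (posteriorProb (Pr n) p₀ (fun i : Fin n => X i ω)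
        {p : F | absMoment (r + δ) (p : ProbDensity).toMeasure ≤ ENNReal.ofReal K}).toReal)
      atTop (fun _ => 1)) :
    ∀ ε : ℝ, 0 < ε → TendstoInMeasure μ
      (fun n ω => (posteriorProb (Pr n) p₀ (fun i : Fin n => X i ω)
        {p : F | ENNReal.ofReal ε <
          wasserstein r (p : ProbDensity).toMeasure p₀.toMeasure}).toReal)
      atTop (fun _ => 0) := by
  intro ε hε
  obtain ⟨N, C, η, hη, hη1, hC, hW⟩ :=
    exists_finite_family_wasserstein_le hr hδ hK hε p₀.toMeasure hmoment
  set M : Set F := {p : F | absMoment (r + δ) (p : ProbDensity).toMeasure ≤ ENNReal.ofReal K}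
    with hM
  let A : Option (Fin N) → Set F := fun k =>
    {p : F | p₀.toMeasure (C k) + ENNReal.ofReal η ≤ (p : ProbDensity).toMeasure (C k)}
  have hMm : MeasurableSet M := measurableSet_le
    (measurable_lintegral_toMeasure hF (measurable_ofReal_abs_rpow _)) measurable_const
  have hAm : ∀ k, MeasurableSet (A k) := fun k => by
    refine measurableSet_le measurable_const ?_
    have := measurable_lintegral_toMeasure hF (measurable_one.indicator (hC k))
    simpa only [lintegral_indicator_one (hC k)] using this
  have hAC : ∀ k, ∀ p ∈ A k,
      p₀.toMeasure.real (C k) + η ≤ (p : ProbDensity).toMeasure.real (C k) := fun k p hp => by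
    have h := ENNReal.toReal_mono (measure_ne_top _ _) (show _ ≤ _ from hp)
    rwa [ENNReal.toReal_add (measure_ne_top _ _) ENNReal.ofReal_ne_top,
      ENNReal.toReal_ofReal hη.le] at h
  -- Only this inclusion is used about the Wasserstein event, so its measurability is never needed.
  have hcover : {p : F | ENNReal.ofReal ε <
      wasserstein r (p : ProbDensity).toMeasure p₀.toMeasure} ⊆ Mᶜ ∪ ⋃ k, A k := by
    intro p hp
    by_contra hnot
    rw [Set.mem_union, not_or, Set.mem_iUnion, not_exists, Set.notMem_compl_iff] at hnot
    exact not_le.2 hp (hW _ hnot.1 fun k => (not_le.1 (hnot.2 k)).le)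
  have hX : ∀ n, AEMeasurable (fun ω (i : Fin n) => X i ω) μ := fun n =>
    aemeasurable_pi_lambda _ fun i => (hXlaw i).aemeasurable
  have hmap : ∀ n, μ.map (fun ω (i : Fin n) => X i ω) =
      Measure.pi fun _ : Fin n => p₀.toMeasure := fun n => by
    rw [(iIndepFun_iff_map_fun_eq_pi_map fun i : Fin n => (hXlaw i).aemeasurable).1
      (hXindep.precomp Fin.val_injective)]
    simp only [(hXlaw _).map_eq]
  rw [tendstoInMeasure_iff_dist] at hpost ⊢
  intro κ hκ
  -- Half of `κ` goes to the failure of the moment bound, half is shared by the `N + 1` pieces.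
  set κ' : ℝ := κ / 2 / (N + 1) with hκ'
  have hκ'0 : 0 < κ' := by positivity
  have hlim : Tendsto (fun n => μ {ω | κ / 2 ≤ dist (posteriorProb (Pr n) p₀
        (fun i : Fin n => X i ω) M).toReal 1} +
      ∑ k, (Measure.pi fun _ : Fin n => p₀.toMeasure)
        {x | ENNReal.ofReal κ' ≤ posteriorProb (Pr n) p₀ x (A k)}) atTop (𝓝 0) := by
    have h := (hpost (κ / 2) (by positivity)).add (tendsto_finsetSum Finset.univ fun k _ =>
      tendsto_measure_le_posteriorProb hF Pr p₀ hKL (hC k) hη hη1 (hAm k) (hAC k) hκ'0)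
    simpa using h
  refine tendsto_of_tendsto_of_tendsto_of_le_of_le tendsto_const_nhds hlim
    (fun _ => zero_le) fun n => ?_
  have hsub : {ω | κ ≤ dist (posteriorProb (Pr n) p₀ (fun i : Fin n => X i ω)
      {p : F | ENNReal.ofReal ε <
        wasserstein r (p : ProbDensity).toMeasure p₀.toMeasure}).toReal 0} ⊆
      {ω | κ / 2 ≤ dist (posteriorProb (Pr n) p₀ (fun i : Fin n => X i ω) M).toReal 1} ∪
      ⋃ k, (fun ω (i : Fin n) => X i ω) ⁻¹'
        {x | ENNReal.ofReal κ' ≤ posteriorProb (Pr n) p₀ x (A k)} := by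
    intro ω hω
    by_contra hnot
    simp only [Set.mem_union, Set.mem_iUnion, Set.mem_preimage, Set.mem_ofPred_eq, not_or,
      not_exists, not_le] at hnot
    obtain ⟨h1, h2⟩ := hnot
    change κ ≤ dist _ _ at hω
    set x : Fin n → ℝ := fun i => X i ω with hx
    have hne : ∀ B : Set F, posteriorProb (Pr n) p₀ x B ≠ ∞ := fun B =>
      ((posteriorProb_le_one (Pr n) p₀ x B).trans_lt ENNReal.one_lt_top).ne
    have hMc : (posteriorProb (Pr n) p₀ x M).toReal + (posteriorProb (Pr n) p₀ x Mᶜ).toReal ≤ 1 := by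
      have := ENNReal.toReal_mono ENNReal.one_ne_top (posteriorProb_add_compl_le (Pr n) p₀ x hMm)
      rwa [ENNReal.toReal_add (hne _) (hne _), ENNReal.toReal_one] at this
    have hU : (posteriorProb (Pr n) p₀ x (⋃ k, A k)).toReal ≤ (N + 1) * κ' := by
      refine ENNReal.toReal_le_of_le_ofReal (by positivity) ?_
      calc posteriorProb (Pr n) p₀ x (⋃ k, A k)
          ≤ ∑ k, posteriorProb (Pr n) p₀ x (A k) := posteriorProb_iUnion_le _ _ _ _
        _ ≤ ∑ _k : Option (Fin N), ENNReal.ofReal κ' := Finset.sum_le_sum fun k _ => (h2 k).le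
        _ = _ := by
            rw [Finset.sum_const, Finset.card_univ, Fintype.card_option, Fintype.card_fin,
              nsmul_eq_mul, ENNReal.ofReal_mul (by positivity), ← Nat.cast_add_one,
              ENNReal.ofReal_natCast]
    have hsum : (posteriorProb (Pr n) p₀ x {p : F | ENNReal.ofReal ε <
        wasserstein r (p : ProbDensity).toMeasure p₀.toMeasure}).toReal ≤
        (posteriorProb (Pr n) p₀ x Mᶜ).toReal + (posteriorProb (Pr n) p₀ x (⋃ k, A k)).toReal := by
      rw [← ENNReal.toReal_add (hne _) (hne _)]
      exact ENNReal.toReal_mono (ENNReal.add_ne_top.2 ⟨hne _, hne _⟩)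
        ((posteriorProb_mono _ _ _ hcover).trans (posteriorProb_union_le _ _ _ _ _))
    rw [Real.dist_eq, sub_zero, abs_of_nonneg ENNReal.toReal_nonneg] at hω
    rw [Real.dist_eq, abs_lt] at h1
    have : (N + 1 : ℝ) * κ' = κ / 2 := by rw [hκ']; field_simp
    linarith [h1.1]
  refine (measure_mono hsub).trans ((measure_union_le _ _).trans ?_)
  gcongr
  refine (measure_iUnion_fintype_le _ _).trans (Finset.sum_le_sum fun k _ => ?_)
  rw [← hmap n]
  -- This inequality for the image measure holds for arbitrary sets, so the posterior event need not
  -- be measurable.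
  exact Measure.le_map_apply (hX n) _
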